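/- Let $G=(V,E)$ be a finite connected (nonempty) simple graph. For a nonempty set $I\subseteq V$ let $H_I=\ker\sum_{i\in I}x_i\subset\mathbb{Q}^V$, where $x_i$ denotes the $i$-th coordinate form, and let $$\mathcal{A}_G=\{H_I \mid \emptyset\neq I\subseteq V,\ \text{the induced subgraph } G[I] \text{ is connected}\}$$ be the connected subgraph arrangement of $G$ in $\mathbb{Q}^V$. An open simplicial cone in $\mathbb{Q}^V$ is the set of all linear combinations with strictly positive rational coefficients of the vectors of a basis of $\mathbb{Q}^V$. An arrangement $\mathcal{A}$ of hyperplanes in $\mathbb{Q}^V$ is called simplicial if the complement $\mathbb{Q}^V\setminus\bigcup_{H\in\mathcal{A}}H$ decomposes into, i.e. is a disjoint union of, open simplicial cones. Then $\mathcal{A}_G$ is simplicial if and only if $G$ is a triangle (the complete graph $K_3$) or a path graph $P_n$ on $n\geq 1$ vertices. -/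

import Mathlib

/-- The hyperplane `H_I = ker (∑ i ∈ I, x_i)` in `F^V`, where `x_i` is the `i`-th coordinate form. -/
def coordSumKer (F : Type*) [Field F] {V : Type*} (I : Finset V) : Submodule F (V → F) :=
  LinearMap.ker (∑ i ∈ I, (LinearMap.proj i : (V → F) →ₗ[F] F))

/-- The connected subgraph arrangement of `G` over `F`: all hyperplanes `H_I` such that `I` is a
nonempty set of vertices and the induced subgraph `G[I]` is connected. -/
def connectedSubgraphArrangement (F : Type*) [Field F] {V : Type*} (G : SimpleGraph V) :
    Set (Submodule F (V → F)) :=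
  {H | ∃ I : Finset V, I.Nonempty ∧ (G.induce (I : Set V)).Connected ∧ H = coordSumKer F I}

/-- An open simplicial cone in `ℚ^V`: the set of all linear combinations with strictly positive
coefficients of the vectors of some basis of `ℚ^V`. -/
def IsOpenSimplicialCone {V : Type*} [Fintype V] (C : Set (V → ℚ)) : Prop :=
  ∃ b : Module.Basis V ℚ (V → ℚ),
    C = {x | ∃ c : V → ℚ, (∀ i, 0 < c i) ∧ x = ∑ i, c i • b i}

/-- The complement of the union of the hyperplanes of an arrangement in `ℚ^V`. -/
def arrangementComplement {V : Type*} (A : Set (Submodule ℚ (V → ℚ))) : Set (V → ℚ) :=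
  (⋃ H ∈ A, (H : Set (V → ℚ)))ᶜ

/-- An arrangement in `ℚ^V` is simplicial if the complement of its hyperplanes decomposes into
(that is, is the union of a family of pairwise disjoint) open simplicial cones. Such cones are
the chambers: a boundary point of one of the cones that lies in the complement would lie in
another of them, which is open and so meets the first one; hence every boundary point lies on a
hyperplane of the arrangement. -/
def IsSimplicialArrangement {V : Type*} [Fintype V] (A : Set (Submodule ℚ (V → ℚ))) : Prop :=
  ∃ 𝒞 : Set (Set (V → ℚ)),
    (∀ C ∈ 𝒞, IsOpenSimplicialCone C) ∧ 𝒞.PairwiseDisjoint id ∧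
      ⋃₀ 𝒞 = arrangementComplement A

/-- `G` is a triangle, that is, isomorphic to the complete graph on three vertices. -/
def IsTriangleGraph {V : Type*} (G : SimpleGraph V) : Prop :=
  Nonempty (G ≃g (⊤ : SimpleGraph (Fin 3)))

/-- `G` is a path graph, that is, isomorphic to the path `0 - 1 - ⋯ - (n - 1)` for some `n`. -/
def IsPathGraph {V : Type*} (G : SimpleGraph V) : Prop :=
  ∃ n : ℕ, Nonempty (G ≃g SimpleGraph.pathGraph n)

/-! Necessity. Pairwise disjointness of the cones forces the chamber of any point of the complement
to be one of them (`exists_basis_chamber`). A simplicial cone cannot contain a certain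
quadrilateral: suppose its closure contains points with `m 0 + m 1 = m 2 + m 3`, placed suitably on
the zero sets of four forms, nonnegative on the cone, with f₀ + f₁ = f₂ + f₃. Then on some generator
f₁ is positive while the other three vanish (`not_simplicial_of_quadrilateral`). To produce such a
quadrilateral it is put infinitesimally close to a point `p` at which few forms of the arrangement
vanish, so few signs need checking (`not_simplicial_of_local_quadrilateral`).

This excludes two patterns: a vertex with three neighbours, two of them nonadjacent
(`not_simplicial_of_branch`), and a closed chain of four blocks, three single vertices and a set `D`
(`not_simplicial_of_cycle`). A vertex with three neighbours always yields one of them, so all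
degrees are at most two and a longest path is spanning. Its only possible chord joins its ends; the
resulting cycle is excluded from length four on. A triangle or a path remains.

Sufficiency. The connected sets of a path are intervals, so the forms are differences of partial
sums: the braid arrangement, whose chambers are orderings, cut out by consecutive differences
(`simplicial_of_differences`). For a triangle the forms are the seven subset sums of three
coordinates, and symmetry leaves a short list of chambers (`HasSimplicialChamber.of_ne`). -/

/-! ### Chambers of a simplicial arrangement -/

theorem mem_arrangementComplement_iff {V : Type*} {G : SimpleGraph V} {x : V → ℚ} :
    x ∈ arrangementComplement (connectedSubgraphArrangement ℚ G) ↔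
      ∀ I : Finset V, I.Nonempty → (G.induce (I : Set V)).Connected → ∑ i ∈ I, x i ≠ 0 := by
  simp only [arrangementComplement, connectedSubgraphArrangement, Set.mem_compl_iff,
    Set.mem_iUnion, Set.mem_ofPred_eq, not_exists, SetLike.mem_coe]
  constructor
  · intro h I hI hc h0
    refine h _ ⟨I, hI, hc, rfl⟩ ?_
    simpa [coordSumKer] using h0
  · rintro h _ ⟨I, hI, hc, rfl⟩ h0
    exact h I hI hc (by simpa [coordSumKer] using h0)

theorem mem_openCone_iff {V : Type*} [Fintype V] (b : Module.Basis V ℚ (V → ℚ)) (x : V → ℚ) :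
    (∃ c : V → ℚ, (∀ i, 0 < c i) ∧ x = ∑ i, c i • b i) ↔ ∀ i, 0 < b.repr x i := by
  constructor
  · rintro ⟨c, hc, rfl⟩ i
    rw [b.repr_sum_self]
    exact hc i
  · intro h
    exact ⟨fun i => b.repr x i, h, (b.sum_repr x).symm⟩

/-- Finitely many strict inequalities survive a small step in a given direction. -/
theorem exists_small_step {ι : Type*} [Finite ι] (u w : ι → ℚ) (hu : ∀ i, 0 < u i) :
    ∃ δ : ℚ, 0 < δ ∧ ∀ i, 0 < u i + δ * w i := by
  have key : ∀ i, ∀ᶠ δ : ℚ in nhdsWithin 0 (Set.Ioi 0), 0 < u i + δ * w i := by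
    intro i
    have : Filter.Tendsto (fun δ : ℚ => u i + δ * w i) (nhds 0) (nhds (u i + 0 * w i)) :=
      Continuous.tendsto (by fun_prop) 0
    refine (this.eventually (lt_mem_nhds ?_)).filter_mono nhdsWithin_le_nhds
    simpa using hu i
  obtain ⟨δ, h1, h2⟩ := ((Filter.eventually_all.2 key).and self_mem_nhdsWithin).exists
  exact ⟨δ, h2, h1⟩

/-- In a simplicial arrangement every chamber is an open simplicial cone. -/
theorem exists_basis_chamber {V : Type*} [Fintype V] {G : SimpleGraph V}
    (h : IsSimplicialArrangement (connectedSubgraphArrangement ℚ G)) {r : V → ℚ}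
    (hr : r ∈ arrangementComplement (connectedSubgraphArrangement ℚ G)) :
    ∃ b : Module.Basis V ℚ (V → ℚ), (∀ i, 0 < b.repr r i) ∧
      (∀ s, (∀ i, 0 < b.repr s i) →
        s ∈ arrangementComplement (connectedSubgraphArrangement ℚ G)) ∧
      ∀ s : V → ℚ, (∀ I : Finset V, I.Nonempty → (G.induce (I : Set V)).Connected →
        0 < (∑ i ∈ I, s i) * ∑ i ∈ I, r i) → ∀ i, 0 < b.repr s i := by
  obtain ⟨C, hC, hdisj, hU⟩ := h
  have hr' := hr
  rw [← hU] at hr'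
  obtain ⟨K, hK, hrK⟩ := hr'
  obtain ⟨b, hb⟩ := hC K hK
  have hmem : ∀ x, x ∈ K ↔ ∀ i, 0 < b.repr x i := fun x => by
    rw [hb]; exact mem_openCone_iff b x
  have hrb := (hmem r).1 hrK
  refine ⟨b, hrb, fun s hs => hU ▸ ⟨K, hK, (hmem s).2 hs⟩, fun s hs => ?_⟩
  by_contra hcon
  push Not at hcon
  obtain ⟨j, hj⟩ := hcon
  have : Nonempty V := ⟨j⟩
  -- With the least coordinate ratio `ρ`, the point `s - ρ • r` lies on the boundary of `K`. Since
  -- `ρ ≤ 0` it still has the signs of `r`, so it lies in another cone `K'`; a small step along `r`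
  -- then lands in both `K` and `K'`.
  obtain ⟨i₀, hi₀⟩ := Finite.exists_min (fun i => b.repr s i / b.repr r i)
  set ρ := b.repr s i₀ / b.repr r i₀ with hρ
  have hρ0 : ρ ≤ 0 := (hi₀ j).trans (div_nonpos_of_nonpos_of_nonneg hj (hrb j).le)
  have hm : s - ρ • r ∈ arrangementComplement (connectedSubgraphArrangement ℚ G) := by
    rw [mem_arrangementComplement_iff] at hr ⊢
    intro I hI hc h0
    have h1 := hs I hI hc
    have h2 : ∑ i ∈ I, s i = ρ * ∑ i ∈ I, r i := by
      simp only [Pi.sub_apply, Pi.smul_apply, smul_eq_mul, Finset.sum_sub_distrib,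
        ← Finset.mul_sum] at h0
      linarith
    rw [h2, mul_assoc] at h1
    nlinarith [mul_self_nonneg (∑ i ∈ I, r i)]
  rw [← hU] at hm
  obtain ⟨K', hK', hmK'⟩ := hm
  obtain ⟨b', hb'⟩ := hC K' hK'
  have hmem' : ∀ x, x ∈ K' ↔ ∀ i, 0 < b'.repr x i := fun x => by
    rw [hb']; exact mem_openCone_iff b' x
  have hnn : ∀ i, 0 ≤ b.repr (s - ρ • r) i := by
    intro i
    have := (le_div_iff₀ (hrb i)).1 (hi₀ i)
    simp only [map_sub, map_smul, Finsupp.coe_sub, Finsupp.coe_smul, Pi.sub_apply,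
      Pi.smul_apply, smul_eq_mul]
    linarith
  have hz : b.repr (s - ρ • r) i₀ = 0 := by
    simp only [map_sub, map_smul, Finsupp.coe_sub, Finsupp.coe_smul, Pi.sub_apply,
      Pi.smul_apply, smul_eq_mul]
    rw [hρ, div_mul_cancel₀ _ (hrb i₀).ne', sub_self]
  have hne : K ≠ K' := by
    rintro rfl
    exact ((hmem _).1 hmK' i₀).ne' hz
  obtain ⟨δ, hδ, hstep⟩ := exists_small_step (fun i => b'.repr (s - ρ • r) i)
    (fun i => b'.repr r i) ((hmem' _).1 hmK')
  have hd : Disjoint K K' := hdisj hK hK' hne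
  refine Set.disjoint_left.1 hd (?_ : (s - ρ • r) + δ • r ∈ K) ?_
  · refine (hmem _).2 fun i => ?_
    rw [map_add, map_smul, Finsupp.add_apply, Finsupp.smul_apply, smul_eq_mul]
    exact add_pos_of_nonneg_of_pos (hnn i) (mul_pos hδ (hrb i))
  · refine (hmem' _).2 fun i => ?_
    rw [map_add, map_smul, Finsupp.add_apply, Finsupp.smul_apply, smul_eq_mul]
    exact hstep i

/-- A form of the arrangement that is positive at a point of a simplicial chamber is nonnegative
on the generators of the chamber. -/
theorem form_nonneg_of_chamber {V : Type*} [Fintype V] {G : SimpleGraph V} {r : V → ℚ}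
    {b : Module.Basis V ℚ (V → ℚ)} (hr : ∀ i, 0 < b.repr r i)
    (hb : ∀ s, (∀ i, 0 < b.repr s i) →
      s ∈ arrangementComplement (connectedSubgraphArrangement ℚ G))
    {I : Finset V} (hI : I.Nonempty) (hc : (G.induce (I : Set V)).Connected) {σ : ℚ}
    (hσ : 0 < σ * ∑ v ∈ I, r v) (j : V) : 0 ≤ σ * ∑ v ∈ I, b j v := by
  by_contra hneg
  push Not at hneg
  -- The ray from `r` in the direction `b j` stays in the open cone; at this `t` it would reach the
  -- hyperplane.
  set t := (σ * ∑ v ∈ I, r v) / (-(σ * ∑ v ∈ I, b j v)) with ht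
  have htpos : 0 < t := div_pos hσ (by linarith)
  have hmul : t * (σ * ∑ v ∈ I, b j v) = -(σ * ∑ v ∈ I, r v) := by
    rw [ht, div_mul_eq_mul_div, div_eq_iff (by linarith)]; ring
  have hs : ∀ i, 0 < b.repr (r + t • b j) i := by
    classical
    intro i
    rw [map_add, map_smul, Finsupp.add_apply, Finsupp.smul_apply, smul_eq_mul, b.repr_self,
      Finsupp.single_apply]
    have := hr i
    split_ifs <;> nlinarith
  refine mem_arrangementComplement_iff.1 (hb _ hs) I hI hc ?_
  have hσ0 : σ ≠ 0 := by rintro rfl; simp at hσ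
  have : σ * ∑ v ∈ I, (r + t • b j) v = 0 := by
    simp only [Pi.add_apply, Pi.smul_apply, smul_eq_mul, Finset.sum_add_distrib,
      ← Finset.mul_sum]
    linear_combination hmul
  exact (mul_eq_zero.1 this).resolve_left hσ0

/-- Points on which all forms have weakly the sign that they have on a chamber lie in its
closure. -/
theorem repr_nonneg_of_chamber {V : Type*} [Fintype V] {G : SimpleGraph V} {r : V → ℚ}
    (hr : r ∈ arrangementComplement (connectedSubgraphArrangement ℚ G))
    {b : Module.Basis V ℚ (V → ℚ)}
    (hb : ∀ s : V → ℚ, (∀ I : Finset V, I.Nonempty → (G.induce (I : Set V)).Connected →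
        0 < (∑ i ∈ I, s i) * ∑ i ∈ I, r i) → ∀ i, 0 < b.repr s i)
    {m : V → ℚ} (hm : ∀ I : Finset V, I.Nonempty → (G.induce (I : Set V)).Connected →
        0 ≤ (∑ i ∈ I, m i) * ∑ i ∈ I, r i) (j : V) : 0 ≤ b.repr m j := by
  refine le_of_forall_pos_lt_add fun ε hε => ?_
  have hrr : 0 < b.repr r j := hb r (fun I hI hc =>
    mul_self_pos.2 (mem_arrangementComplement_iff.1 hr I hI hc)) j
  -- Moving `m` towards `r` makes all signs strict; the factor raises the `j`-th coordinate by
  -- exactly `ε`.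
  have := hb (m + (ε / b.repr r j) • r) (fun I hI hc => by
    have h1 := hm I hI hc
    have h2 := mul_self_pos.2 (mem_arrangementComplement_iff.1 hr I hI hc)
    have h3 : 0 < ε / b.repr r j := div_pos hε hrr
    simp only [Pi.add_apply, Pi.smul_apply, smul_eq_mul, Finset.sum_add_distrib,
      ← Finset.mul_sum]
    nlinarith [mul_pos h3 h2]) j
  rw [map_add, map_smul, Finsupp.add_apply, Finsupp.smul_apply, smul_eq_mul,
    div_mul_cancel₀ _ hrr.ne'] at this
  exact this

/-! ### The quadrilateral obstruction -/

theorem sum_form_repr {V : Type*} [Fintype V] (b : Module.Basis V ℚ (V → ℚ)) (I : Finset V)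
    (σ : ℚ) (m : V → ℚ) :
    σ * ∑ v ∈ I, m v = ∑ i, b.repr m i * (σ * ∑ v ∈ I, b i v) := by
  conv_lhs => rw [← b.sum_repr m]
  simp only [Finset.sum_apply, Pi.smul_apply, smul_eq_mul]
  rw [Finset.sum_comm, Finset.mul_sum]
  refine Finset.sum_congr rfl fun i _ => ?_
  rw [← Finset.mul_sum]
  ring

/-- A chamber whose closure contains the corners `m₁, m₃, m₂, m₄` of a quadrilateral cut out by
four forms `f₁, f₂, f₃, f₄` with `f₁ + f₂ = f₃ + f₄` is not a simplicial cone. -/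
theorem not_simplicial_of_quadrilateral {V : Type*} [Fintype V] {G : SimpleGraph V}
    (m : Fin 4 → V → ℚ) (hm : m 0 + m 1 = m 2 + m 3)
    (hsign : ∀ I : Finset V, I.Nonempty → (G.induce (I : Set V)).Connected →
      ((∀ k, 0 ≤ ∑ v ∈ I, m k v) ∧ 0 < ∑ v ∈ I, m 0 v + ∑ v ∈ I, m 1 v) ∨
      ((∀ k, ∑ v ∈ I, m k v ≤ 0) ∧ ∑ v ∈ I, m 0 v + ∑ v ∈ I, m 1 v < 0))
    (J : Fin 4 → Finset V) (hJ : ∀ k, (J k).Nonempty)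
    (hJc : ∀ k, (G.induce (J k : Set V)).Connected) (σ : Fin 4 → ℚ)
    (hrel : ∀ x : V → ℚ, σ 0 * ∑ v ∈ J 0, x v + σ 1 * ∑ v ∈ J 1, x v =
      σ 2 * ∑ v ∈ J 2, x v + σ 3 * ∑ v ∈ J 3, x v)
    (hpos : ∀ k, 0 < σ k * (∑ v ∈ J k, m 0 v + ∑ v ∈ J k, m 1 v))
    (h10 : 0 < σ 1 * ∑ v ∈ J 1, m 0 v)
    (h00 : ∑ v ∈ J 0, m 0 v = 0) (h20 : ∑ v ∈ J 2, m 0 v = 0)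
    (h13 : ∑ v ∈ J 1, m 3 v = 0) (h32 : ∑ v ∈ J 3, m 2 v = 0) :
    ¬ IsSimplicialArrangement (connectedSubgraphArrangement ℚ G) := by
  intro h
  have hrsum : ∀ I : Finset V, ∑ v ∈ I, (m 0 + m 1) v = ∑ v ∈ I, m 0 v + ∑ v ∈ I, m 1 v :=
    fun I => by simp [Finset.sum_add_distrib]
  have hr : m 0 + m 1 ∈ arrangementComplement (connectedSubgraphArrangement ℚ G) := by
    rw [mem_arrangementComplement_iff]
    intro I hI hc
    rw [hrsum]
    rcases hsign I hI hc with h | h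
    · exact h.2.ne'
    · exact h.2.ne
  obtain ⟨b, hrb, hb1, hb2⟩ := exists_basis_chamber h hr
  have hf : ∀ k i, 0 ≤ σ k * ∑ v ∈ J k, b i v := fun k i =>
    form_nonneg_of_chamber hrb hb1 (hJ k) (hJc k) (by rw [hrsum]; exact hpos k) i
  have hc : ∀ k i, 0 ≤ b.repr (m k) i := fun k i =>
    repr_nonneg_of_chamber hr hb2 (fun I hI hc => by
      rw [hrsum]
      rcases hsign I hI hc with h | h
      · exact mul_nonneg (h.1 k) h.2.le
      · exact mul_nonneg_of_nonpos_of_nonpos (h.1 k) h.2.le) i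
  -- A vanishing sum of nonnegative terms: if a form is zero at a point of the closed cone, it is
  -- zero on every generator that this point uses.
  have hzero : ∀ k l, ∑ v ∈ J k, m l v = 0 → ∀ i,
      b.repr (m l) i * (σ k * ∑ v ∈ J k, b i v) = 0 := fun k l h0 i => by
    have h1 := sum_form_repr b (J k) (σ k) (m l)
    rw [h0, mul_zero] at h1
    exact (Finset.sum_eq_zero_iff_of_nonneg
      (fun i _ => mul_nonneg (hc l i) (hf k i))).1 h1.symm i (Finset.mem_univ i)
  rw [sum_form_repr b] at h10
  -- A generator used by `m 0` on which the form 1 is positive. It is not used by `m 3`, hence it is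
  -- used by `m 2`; so the forms 0, 2, 3 vanish on it, against `hrel`.
  obtain ⟨i, -, hi⟩ := Finset.exists_lt_of_sum_lt (s := Finset.univ) (f := fun _ => (0 : ℚ))
    (by simpa using h10)
  have hc0 : 0 < b.repr (m 0) i := pos_of_mul_pos_left hi (hf 1 i)
  have hf1 : 0 < σ 1 * ∑ v ∈ J 1, b i v := pos_of_mul_pos_right hi (hc 0 i)
  have hc3 : b.repr (m 3) i = 0 := (mul_eq_zero.1 (hzero 1 3 h13 i)).resolve_right hf1.ne'
  have hc2 : 0 < b.repr (m 2) i := by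
    have := congrArg (fun x => b.repr x i) hm
    simp only [map_add, Finsupp.add_apply, hc3, add_zero] at this
    linarith [hc 1 i]
  have e0 := (mul_eq_zero.1 (hzero 0 0 h00 i)).resolve_left hc0.ne'
  have e2 := (mul_eq_zero.1 (hzero 2 0 h20 i)).resolve_left hc0.ne'
  have e3 := (mul_eq_zero.1 (hzero 3 2 h32 i)).resolve_left hc2.ne'
  have := hrel (b i)
  linarith

/-- An integral, local form of the obstruction: the quadrilateral lies infinitesimally close to
the point `p`, so that only the forms vanishing at `p` matter. -/
theorem not_simplicial_of_local_quadrilateral {V : Type*} [Fintype V] {G : SimpleGraph V}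
    (p : V → ℤ) (q : Fin 4 → V → ℤ) (hq : q 0 + q 1 = q 2 + q 3)
    (hsign : ∀ I : Finset V, I.Nonempty → (G.induce (I : Set V)).Connected →
      ∑ v ∈ I, p v = 0 →
      ((∀ k, 0 ≤ ∑ v ∈ I, q k v) ∧ 0 < ∑ v ∈ I, q 0 v + ∑ v ∈ I, q 1 v) ∨
      ((∀ k, ∑ v ∈ I, q k v ≤ 0) ∧ ∑ v ∈ I, q 0 v + ∑ v ∈ I, q 1 v < 0))
    (J : Fin 4 → Finset V) (hJ : ∀ k, (J k).Nonempty)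
    (hJc : ∀ k, (G.induce (J k : Set V)).Connected) (hJp : ∀ k, ∑ v ∈ J k, p v = 0)
    (σ : Fin 4 → ℤ)
    (hrel : ∀ x : V → ℚ, σ 0 * ∑ v ∈ J 0, x v + σ 1 * ∑ v ∈ J 1, x v =
      σ 2 * ∑ v ∈ J 2, x v + σ 3 * ∑ v ∈ J 3, x v)
    (hpos : ∀ k, 0 < σ k * (∑ v ∈ J k, q 0 v + ∑ v ∈ J k, q 1 v))
    (h10 : 0 < σ 1 * ∑ v ∈ J 1, q 0 v)
    (h00 : ∑ v ∈ J 0, q 0 v = 0) (h20 : ∑ v ∈ J 2, q 0 v = 0)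
    (h13 : ∑ v ∈ J 1, q 3 v = 0) (h32 : ∑ v ∈ J 3, q 2 v = 0) :
    ¬ IsSimplicialArrangement (connectedSubgraphArrangement ℚ G) := by
  -- `N` exceeds every |∑ q k|, so at `N * p + q k` the sign of an integer form is that of its value
  -- at `p` unless this is zero.
  set N : ℤ := 1 + ∑ k, ∑ v, |q k v| with hN
  have hbound : ∀ k (I : Finset V), |∑ v ∈ I, q k v| < N := by
    intro k I
    have h1 : |∑ v ∈ I, q k v| ≤ ∑ v, |q k v| :=
      (Finset.abs_sum_le_sum_abs _ _).trans
        (Finset.sum_le_sum_of_subset_of_nonneg (Finset.subset_univ _) fun _ _ _ => abs_nonneg _)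
    have h2 : ∑ v, |q k v| ≤ ∑ k, ∑ v, |q k v| :=
      Finset.single_le_sum (f := fun k => ∑ v, |q k v|)
        (fun _ _ => Finset.sum_nonneg fun _ _ => abs_nonneg _) (Finset.mem_univ k)
    linarith
  have hsum : ∀ k (I : Finset V), ∑ v ∈ I, ((N * p v + q k v : ℤ) : ℚ) =
      ((N * ∑ v ∈ I, p v + ∑ v ∈ I, q k v : ℤ) : ℚ) := by
    intro k I
    rw [← Int.cast_sum, Finset.sum_add_distrib, Finset.mul_sum]
  have hsum0 : ∀ k l, ∑ v ∈ J k, ((N * p v + q l v : ℤ) : ℚ) =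
      ((∑ v ∈ J k, q l v : ℤ) : ℚ) := by
    intro k l
    rw [hsum, hJp, mul_zero, zero_add]
  refine not_simplicial_of_quadrilateral (fun k v => ((N * p v + q k v : ℤ) : ℚ)) ?_ ?_ J hJ hJc
    (fun k => (σ k : ℚ)) hrel ?_ ?_ ?_ ?_ ?_ ?_
  · ext v
    have := congrFun hq v
    simp only [Pi.add_apply] at this ⊢
    norm_cast
    linarith
  · intro I hI hc
    simp only [hsum]
    norm_cast
    have hb : ∀ k, -N < ∑ v ∈ I, q k v ∧ ∑ v ∈ I, q k v < N := fun k => abs_lt.1 (hbound k I)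
    rcases lt_trichotomy (∑ v ∈ I, p v) 0 with h | h | h
    · right
      have hlt : ∀ k, N * ∑ v ∈ I, p v + ∑ v ∈ I, q k v < 0 := fun k => by
        nlinarith [hb k]
      exact ⟨fun k => (hlt k).le, add_neg (hlt 0) (hlt 1)⟩
    · simpa only [h, mul_zero, zero_add] using hsign I hI hc h
    · left
      have hlt : ∀ k, 0 < N * ∑ v ∈ I, p v + ∑ v ∈ I, q k v := fun k => by
        nlinarith [hb k]
      exact ⟨fun k => (hlt k).le, add_pos (hlt 0) (hlt 1)⟩
  · intro k
    simp only [hsum0]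
    exact_mod_cast hpos k
  · simp only [hsum0]
    exact_mod_cast h10
  · simp only [hsum0]
    exact_mod_cast h00
  · simp only [hsum0]
    exact_mod_cast h20
  · simp only [hsum0]
    exact_mod_cast h13
  · simp only [hsum0]
    exact_mod_cast h32

/-! ### Weight sums and connected vertex sets -/

theorem sum_pick {V : Type*} [DecidableEq V] (I : Finset V) (a : V) (t : ℤ) :
    ∑ v ∈ I, (if v = a then t else 0) = if a ∈ I then t else 0 := by
  rw [Finset.sum_ite_eq']

theorem sum_indicator {V : Type*} [DecidableEq V] (I D : Finset V) (t : ℤ) :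
    ∑ v ∈ I, (if v ∈ D then t else 0) = t * (I ∩ D).card := by
  rw [Finset.sum_ite_mem, Finset.sum_const, nsmul_eq_mul, mul_comm]

theorem connected_coe_of_connected {V : Type*} {G : SimpleGraph V} {S : Set V} {I : Finset V}
    (h : (G.induce S).Connected) (e : ∀ v, v ∈ I ↔ v ∈ S) :
    (G.induce (I : Set V)).Connected := by
  have : S = (I : Set V) := by ext v; exact (e v).symm
  rwa [this] at h

theorem connected_singleton {V : Type*} {G : SimpleGraph V} (a : V) :
    (G.induce (({a} : Finset V) : Set V)).Connected := by
  refine connected_coe_of_connected (S := {a}) ?_ (by simp)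
  rw [SimpleGraph.induce_singleton_eq_top]
  exact SimpleGraph.connected_top

theorem connected_pair {V : Type*} [DecidableEq V] {G : SimpleGraph V} {a b : V}
    (h : G.Adj a b) : (G.induce (({a, b} : Finset V) : Set V)).Connected :=
  connected_coe_of_connected (SimpleGraph.induce_pair_connected_of_adj h) (by simp)

theorem connected_union {V : Type*} [DecidableEq V] {G : SimpleGraph V} {I J K : Finset V}
    (hI : (G.induce (I : Set V)).Connected) (hJ : (G.induce (J : Set V)).Connected)
    {a : V} (haI : a ∈ I) (haJ : a ∈ J) (e : ∀ v, v ∈ K ↔ v ∈ I ∨ v ∈ J) :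
    (G.induce (K : Set V)).Connected :=
  connected_coe_of_connected (SimpleGraph.induce_union_connected hI.preconnected
    hJ.preconnected ⟨a, haI, haJ⟩) (by simpa using e)

/-! ### The cycle obstruction -/

/-- The coefficients are separated in size: `A + B - C` is too small to compensate a multiple of 10.
Here `A, B, C, E` indicate whether a set contains `a, b, c, d`, and `k`, `r` count its elements in
`D` and in the remaining vertices `R`. A set of weight zero avoids `R` and contains all of `D` or
none of it. -/
theorem cycle_arithmetic {A B C E k n r : ℤ} (hA : 0 ≤ A ∧ A ≤ 1) (hB : 0 ≤ B ∧ B ≤ 1)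
    (hC : 0 ≤ C ∧ C ≤ 1) (hE : E = 0 ∨ E = 1) (hk : 0 ≤ k) (hkn : k ≤ n) (hr : 0 ≤ r)
    (hEk : E = 1 → 1 ≤ k) (hkE : k = n → E = 1)
    (h : A + B - C - (10 * n + 1) * E + 10 * k + (10 * n + 10) * r = 0) :
    r = 0 ∧ A + B = C + E ∧ (E = 0 → k = 0) := by
  have hr0 : r = 0 := by
    by_contra hcon
    have h1 : 1 ≤ r := by omega
    have h2 : 10 * n + 10 ≤ (10 * n + 10) * r := le_mul_of_one_le_right (by linarith) h1
    rcases hE with rfl | rfl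
    · linarith
    · linarith [hEk rfl]
  subst hr0
  rcases hE with rfl | rfl
  · omega
  · have : k = n := by omega
    omega

/-- The obstruction coming from a cycle of length four of disjoint blocks `{a}, {c}, {b}, D`. -/
theorem not_simplicial_of_cycle {V : Type*} [Fintype V] [DecidableEq V] {G : SimpleGraph V}
    {a b c : V} {D : Finset V} (hab : a ≠ b) (hac : a ≠ c) (hbc : b ≠ c)
    (haD : a ∉ D) (hbD : b ∉ D) (hcD : c ∉ D) (hD : D.Nonempty)
    (h1 : G.Adj a c) (h2 : G.Adj b c)
    (h3 : (G.induce ((insert a D : Finset V) : Set V)).Connected)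
    (h4 : (G.induce ((insert b D : Finset V) : Set V)).Connected) :
    ¬ IsSimplicialArrangement (connectedSubgraphArrangement ℚ G) := by
  obtain ⟨d, hd⟩ := hD
  have had : a ≠ d := fun h => haD (h ▸ hd)
  have hbd : b ≠ d := fun h => hbD (h ▸ hd)
  have hcd : c ≠ d := fun h => hcD (h ▸ hd)
  set R : Finset V := (insert a (insert b (insert c D)))ᶜ with hR
  set n : ℤ := (D.card : ℤ) with hn
  -- The weights total 1, 1, -1, -1 on the blocks `a`, `b`, `c`, `D`. The excess at `d` makes `D`
  -- behave as one vertex, and the weight on `R` keeps sets meeting `R` away from zero.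
  set p : V → ℤ := fun v => (if v = a then 1 else 0) + (if v = b then 1 else 0) +
    (if v = c then -1 else 0) + (if v = d then -(10 * n + 1) else 0) +
    (if v ∈ D then 10 else 0) + (if v ∈ R then 10 * n + 10 else 0) with hp
  -- The block `D` carries its weight at `d` alone, which suffices since only sets containing or
  -- avoiding all of `D` matter.
  set w : ℤ → ℤ → ℤ → ℤ → V → ℤ := fun A B C E v => (if v = a then A else 0) +
    (if v = b then B else 0) + (if v = c then C else 0) + (if v = d then E else 0) with hw
  have hpsum : ∀ I : Finset V, ∑ v ∈ I, p v = (if a ∈ I then 1 else 0) +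
      (if b ∈ I then 1 else 0) + (if c ∈ I then -1 else 0) +
      (if d ∈ I then -(10 * n + 1) else 0) + 10 * (I ∩ D).card +
      (10 * n + 10) * (I ∩ R).card := by
    intro I
    simp only [hp, Finset.sum_add_distrib, sum_pick, sum_indicator]
  have hwsum : ∀ A B C E (I : Finset V), ∑ v ∈ I, w A B C E v = (if a ∈ I then A else 0) +
      (if b ∈ I then B else 0) + (if c ∈ I then C else 0) + (if d ∈ I then E else 0) := by
    intro A B C E I
    simp only [hw, Finset.sum_add_distrib, sum_pick]
  have hwD : ∀ A B C E, ∑ v ∈ D, w A B C E v = E := by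
    intro A B C E
    simp [hwsum, haD, hbD, hcD, hd]
  have hpD : ∑ v ∈ D, p v = -1 := by
    have : D ∩ R = ∅ := by
      ext v; simp [hR]; tauto
    simp [hpsum, haD, hbD, hcD, hd, this, ← hn]
  have hwa : ∀ A B C E, w A B C E a = A := by intros; simp [hw, hab, hac, had]
  have hwb : ∀ A B C E, w A B C E b = B := by intros; simp [hw, hab.symm, hbc, hbd]
  have hwc : ∀ A B C E, w A B C E c = C := by intros; simp [hw, hac.symm, hbc.symm, hcd]
  have hpa : p a = 1 := by simp [hp, hab, hac, had, haD, hR]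
  have hpb : p b = 1 := by simp [hp, hab.symm, hbc, hbd, hbD, hR]
  have hpc : p c = -1 := by simp [hp, hac.symm, hbc.symm, hcd, hcD, hR]
  have hJ0 : ∀ x : V → ℤ, ∑ v ∈ ({a, c} : Finset V), x v = x a + x c := fun x =>
    Finset.sum_pair hac
  have hJ3 : ∀ x : V → ℤ, ∑ v ∈ ({b, c} : Finset V), x v = x b + x c := fun x =>
    Finset.sum_pair hbc
  have hJ1 : ∀ x : V → ℤ, ∑ v ∈ insert b D, x v = x b + ∑ v ∈ D, x v := fun x =>
    Finset.sum_insert hbD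
  have hJ2 : ∀ x : V → ℤ, ∑ v ∈ insert a D, x v = x a + ∑ v ∈ D, x v := fun x =>
    Finset.sum_insert haD
  refine not_simplicial_of_local_quadrilateral p
    ![w (-1) 1 1 1, w 1 (-1) 1 1, w 0 0 0 2, w 0 0 2 0] ?_ ?_
    ![{a, c}, insert b D, insert a D, {b, c}] ?_ ?_ ?_ ![1, 1, 1, 1] ?_ ?_ ?_ ?_ ?_ ?_ ?_
  · ext v
    simp only [Matrix.cons_val, hw, Pi.add_apply]
    split_ifs <;> norm_num
  · intro I hI _ h0
    left
    have hkle : (I ∩ D).card ≤ D.card := Finset.card_le_card Finset.inter_subset_right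
    have hdk : d ∈ I → 1 ≤ (I ∩ D).card := fun h =>
      Finset.card_pos.2 ⟨d, Finset.mem_inter.2 ⟨h, hd⟩⟩
    have hfull : (I ∩ D).card = D.card → d ∈ I := fun h => by
      have := Finset.eq_of_subset_of_card_le Finset.inter_subset_right h.ge
      exact (Finset.mem_inter.1 (this.symm ▸ hd : d ∈ I ∩ D)).1
    have hne : ¬ (a ∉ I ∧ b ∉ I ∧ c ∉ I ∧ (I ∩ D).card = 0 ∧ (I ∩ R).card = 0) := by
      rintro ⟨ha, hb, hc, hk, hr⟩
      obtain ⟨v, hv⟩ := hI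
      rw [Finset.card_eq_zero] at hk hr
      have k1 : v ∉ D := fun h => by
        have : v ∈ I ∩ D := Finset.mem_inter.2 ⟨hv, h⟩
        simp [hk] at this
      have k2 : v ∉ R := fun h => by
        have : v ∈ I ∩ R := Finset.mem_inter.2 ⟨hv, h⟩
        simp [hr] at this
      simp only [hR, Finset.mem_compl, Finset.mem_insert, not_not] at k2
      rcases k2 with rfl | rfl | rfl | h
      exacts [ha hv, hb hv, hc hv, k1 h]
    have hind : ∀ v, 0 ≤ (if v ∈ I then 1 else 0 : ℤ) ∧ (if v ∈ I then 1 else 0 : ℤ) ≤ 1 :=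
      fun v => by split_ifs <;> simp
    have hneg : ∀ v (t : ℤ), (if v ∈ I then t else 0) = t * (if v ∈ I then 1 else 0) :=
      fun v t => by simp
    have hpI := (hpsum I).symm.trans h0
    rw [hneg c, hneg d] at hpI
    obtain ⟨hr0, hbal, hk0⟩ := cycle_arithmetic (hind a) (hind b) (hind c)
      (E := if d ∈ I then 1 else 0) (k := (I ∩ D).card) (n := n) (r := (I ∩ R).card)
      (by split_ifs <;> simp) (Nat.cast_nonneg _) (Nat.cast_le.2 hkle) (Nat.cast_nonneg _)
      (fun h => by
        have : d ∈ I := by by_contra hdI; simp [hdI] at h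
        exact_mod_cast hdk this)
      (fun h => if_pos (hfull (Nat.cast_injective h))) (by linarith)
    -- By the balance `hbal`, each of the four sums is now nonnegative, and the corners 0 and 1
    -- together give twice the number of `c`, `d` in `I`.
    have hwI : ∀ A B C E, ∑ v ∈ I, w A B C E v = A * (if a ∈ I then 1 else 0) +
        B * (if b ∈ I then 1 else 0) + C * (if c ∈ I then 1 else 0) +
        E * (if d ∈ I then 1 else 0) := fun A B C E => by
      rw [hwsum, hneg a, hneg b, hneg c, hneg d]
    have hpos : 0 < (if c ∈ I then 1 else 0 : ℤ) + (if d ∈ I then 1 else 0) := by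
      refine lt_of_le_of_ne (add_nonneg (hind c).1 (hind d).1) fun hcon => hne ?_
      have e1 := hind a
      have e2 := hind b
      have e3 := hind c
      have e4 := hind d
      have hk := hk0 (by linarith)
      have z : ∀ v, (if v ∈ I then 1 else 0 : ℤ) = 0 → v ∉ I := fun v h hv => by simp [hv] at h
      exact ⟨z a (by linarith), z b (by linarith), z c (by linarith), by exact_mod_cast hk,
        by exact_mod_cast hr0⟩
    have e1 := hind a
    have e2 := hind b
    have e3 := hind c
    have e4 := hind d
    simp only [Fin.forall_fin_succ, Matrix.cons_val, Matrix.cons_val_zero, Matrix.cons_val_succ,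
      hwI]
    refine ⟨⟨?_, ?_, ?_, ?_, by simp⟩, ?_⟩
    all_goals linarith
  · simp [Fin.forall_fin_succ]
  · simp only [Fin.forall_fin_succ, Matrix.cons_val_zero]
    exact ⟨connected_pair h1, h4, h3, connected_pair h2, by simp⟩
  · simp [Fin.forall_fin_succ, hJ0, hJ1, hJ2, hJ3, hpa, hpb, hpc, hpD]
  · intro x
    simp [Finset.sum_pair hac, Finset.sum_pair hbc, Finset.sum_insert haD,
      Finset.sum_insert hbD]
    ring
  · simp [Fin.forall_fin_succ, hJ0, hJ1, hJ2, hJ3, hwa, hwb, hwc, hwD]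
  · simp [hJ1, hwb, hwD]
  · simp [hJ0, hwa, hwc]
  · simp [hJ2, hwa, hwD]
  · simp [hJ1, hwb, hwD]
  · simp [hJ3, hwb, hwc]

/-! ### The branch obstruction -/

/-- The obstruction coming from a vertex with three neighbours, two of which are not adjacent. -/
theorem not_simplicial_of_branch {V : Type*} [Fintype V] [DecidableEq V] {G : SimpleGraph V}
    {o x y z : V} (hx : G.Adj o x) (hy : G.Adj o y) (hz : G.Adj o z) (hxy : x ≠ y) (hxz : x ≠ z)
    (hyz : y ≠ z) (hyz' : ¬ G.Adj y z) :
    ¬ IsSimplicialArrangement (connectedSubgraphArrangement ℚ G) := by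
  have hox := hx.ne
  have hoy := hy.ne
  have hoz := hz.ne
  set R : Finset V := ({o, x, y, z} : Finset V)ᶜ with hR
  -- A set of weight zero avoids `R` and contains both or neither of `y` and `z`.
  set p : V → ℤ := fun v => (if v = y then 1 else 0) + (if v = z then -1 else 0) +
    (if v ∈ R then 10 else 0) with hp
  set w : ℤ → ℤ → ℤ → V → ℤ := fun A B C v => (if v = o then A else 0) +
    (if v = x then B else 0) + (if v = y then C else 0) with hw
  have hpsum : ∀ I : Finset V, ∑ v ∈ I, p v = (if y ∈ I then 1 else 0) +
      (if z ∈ I then -1 else 0) + 10 * (I ∩ R).card := by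
    intro I
    simp only [hp, Finset.sum_add_distrib, sum_pick, sum_indicator]
  have hwsum : ∀ A B C (I : Finset V), ∑ v ∈ I, w A B C v = (if o ∈ I then A else 0) +
      (if x ∈ I then B else 0) + (if y ∈ I then C else 0) := by
    intro A B C I
    simp only [hw, Finset.sum_add_distrib, sum_pick]
  have c1 : (G.induce (({o, y, z} : Finset V) : Set V)).Connected :=
    connected_union (connected_pair hy) (connected_pair hz) (a := o) (by simp) (by simp)
      (by intro v; simp; tauto)
  have c2 : (G.induce (({o, x, y, z} : Finset V) : Set V)).Connected :=
    connected_union (connected_pair hx) c1 (a := o) (by simp) (by simp)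
      (by intro v; simp; tauto)
  refine not_simplicial_of_local_quadrilateral p
    ![w 0 1 0, w (-1) 1 0, w 0 1 (-1), w (-1) 1 1] ?_ ?_
    -- With these signs both sides of the relation between the forms equal the coordinate of `x`.
    ![{o}, {o, x}, {o, y, z}, {o, x, y, z}] ?_ ?_ ?_ ![-1, 1, -1, 1] ?_ ?_ ?_ ?_ ?_ ?_ ?_
  · ext v
    simp only [Matrix.cons_val, hw, Pi.add_apply]
    split_ifs <;> norm_num
  · intro I hI hc h0
    have hne : ¬ (o ∉ I ∧ x ∉ I ∧ y ∉ I ∧ z ∉ I ∧ (I ∩ R).card = 0) := by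
      rintro ⟨ha, hb, hc, hk, hr⟩
      obtain ⟨v, hv⟩ := hI
      rw [Finset.card_eq_zero] at hr
      have k2 : v ∉ R := fun h => by
        have : v ∈ I ∩ R := Finset.mem_inter.2 ⟨hv, h⟩
        simp [hr] at this
      simp only [hR, Finset.mem_compl, Finset.mem_insert, Finset.mem_singleton, not_not] at k2
      rcases k2 with rfl | rfl | rfl | rfl
      exacts [ha hv, hb hv, hc hv, hk hv]
    -- The set `{y, z}` is the one whose sums at the corners have mixed signs (0, 0, -1, 1); it is
    -- disconnected because `y` and `z` are not adjacent.
    have hdis : ¬ (o ∉ I ∧ x ∉ I ∧ y ∈ I ∧ z ∈ I ∧ (I ∩ R).card = 0) := by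
      rintro ⟨ho, hx, hy, hz, hr⟩
      rw [Finset.card_eq_zero] at hr
      obtain ⟨q⟩ := hc.preconnected ⟨y, hy⟩ ⟨z, hz⟩
      obtain ⟨d, -, d1, d2⟩ := q.exists_boundary_dart {v | v.1 = y} (by simp) (by simpa using hyz.symm)
      have hadj : G.Adj d.fst.1 d.snd.1 := d.adj
      have d1 : d.fst.1 = y := d1
      have d2 : d.snd.1 ≠ y := d2
      have hm : d.snd.1 ∈ I := d.snd.2
      have k2 : d.snd.1 ∉ R := fun h => by
        have : d.snd.1 ∈ I ∩ R := Finset.mem_inter.2 ⟨hm, h⟩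
        simp [hr] at this
      simp only [hR, Finset.mem_compl, Finset.mem_insert, Finset.mem_singleton, not_not] at k2
      rcases k2 with h | h | h | h
      · exact ho (h ▸ hm)
      · exact hx (h ▸ hm)
      · exact d2 h
      · rw [d1, h] at hadj
        exact hyz' hadj
    rw [hpsum] at h0
    simp only [Fin.forall_fin_succ, Matrix.cons_val, Matrix.cons_val_zero,
      Matrix.cons_val_succ, hwsum]
    by_cases ho : o ∈ I <;> by_cases hxI : x ∈ I <;> by_cases hyI : y ∈ I <;>
      by_cases hzI : z ∈ I <;>
      simp only [ho, hxI, hyI, hzI, if_true, if_false, true_and, false_and, not_true_eq_false,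
        not_false_eq_true] at h0 hne hdis ⊢ <;> first | omega | simp
  · simp [Fin.forall_fin_succ]
  · simp only [Fin.forall_fin_succ, Matrix.cons_val_zero]
    exact ⟨connected_singleton o, connected_pair hx, c1, c2, by simp⟩
  · have hr1 : ({o} : Finset V) ∩ R = ∅ := by ext v; simp [hR]
    have hr2 : ({o, x} : Finset V) ∩ R = ∅ := by ext v; simp [hR]
    have hr3 : ({o, y, z} : Finset V) ∩ R = ∅ := by ext v; simp [hR]
    have hr4 : ({o, x, y, z} : Finset V) ∩ R = ∅ := by ext v; simp [hR]
    simp only [Fin.forall_fin_succ, Matrix.cons_val_zero, Matrix.cons_val_succ, hpsum, hr1, hr2,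
      hr3, hr4]
    simp [hoy.symm, hoz.symm, hxy.symm, hxz.symm]
  · intro u
    simp [Finset.sum_insert, hox, hoy, hoz, hxy, hxz, hyz]
    ring
  all_goals
    simp [Fin.forall_fin_succ, hwsum, hox.symm, hoy.symm, hxy, hxy.symm, hox, hoy, hxz, hyz]

/-! ### Longest paths -/

/-- An injective enumeration of `n` vertices along consecutive edges. -/
def IsPathMap {V : Type*} (G : SimpleGraph V) (n : ℕ) (f : ℕ → V) : Prop :=
  (∀ i < n, ∀ j < n, f i = f j → i = j) ∧ ∀ i, i + 1 < n → G.Adj (f i) (f (i + 1))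

theorem exists_longest_path {V : Type*} [Fintype V] [Nonempty V] (G : SimpleGraph V) :
    ∃ n f, 0 < n ∧ IsPathMap G n f ∧ ∀ m g, IsPathMap G m g → m ≤ n := by
  classical
  have hb : ∀ n, (∃ f, IsPathMap G n f) → n ≤ Fintype.card V := by
    rintro n ⟨f, hf, -⟩
    have := Fintype.card_le_of_injective (fun i : Fin n => f i)
      (fun i j h => Fin.ext (hf i i.2 j j.2 h))
    simpa using this
  obtain ⟨v⟩ := ‹Nonempty V›
  have h1 : ∃ f, IsPathMap G 1 f := ⟨fun _ => v, by intros; omega, by intros; omega⟩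
  have hg := Nat.findGreatest_spec (P := fun n => ∃ f, IsPathMap G n f) (hb 1 h1) h1
  obtain ⟨f, hf⟩ := hg
  exact ⟨_, f, Nat.le_findGreatest (hb 1 h1) h1, hf, fun m g hm =>
    Nat.le_findGreatest (P := fun n => ∃ f, IsPathMap G n f) (hb m ⟨g, hm⟩) ⟨g, hm⟩⟩

theorem connected_path_segment {V : Type*} [DecidableEq V] {G : SimpleGraph V} {n : ℕ}
    {f : ℕ → V} (hf : IsPathMap G n f) (i : ℕ) (k : ℕ) (hk : i + k < n) :
    (G.induce (((Finset.Icc i (i + k)).image f : Finset V) : Set V)).Connected := by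
  induction k with
  | zero => exact connected_coe_of_connected (connected_singleton (G := G) (f i)) (by simp)
  | succ k ih =>
    refine connected_union (ih (by omega)) (connected_pair (hf.2 (i + k) (by omega)))
      (a := f (i + k)) ?_ (by simp) ?_
    · exact Finset.mem_image_of_mem f (by simp)
    · intro v
      simp only [Finset.mem_image, Finset.mem_Icc, Finset.mem_insert, Finset.mem_singleton]
      constructor
      · rintro ⟨j, hj, rfl⟩
        rcases Nat.lt_or_ge j (i + k + 1) with h | h
        · exact Or.inl ⟨j, by omega, rfl⟩
        · right; right; congr 1; omega
      · rintro (⟨j, hj, rfl⟩ | rfl | rfl)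
        · exact ⟨j, by omega, rfl⟩
        · exact ⟨i + k, by omega, rfl⟩
        · exact ⟨i + k + 1, by omega, rfl⟩

theorem eq_of_adj_of_closed {V : Type*} {G : SimpleGraph V} (hG : G.Connected) {S : Set V}
    {u : V} (hu : u ∈ S) (hS : ∀ x ∈ S, ∀ y, G.Adj x y → y ∈ S) (v : V) : v ∈ S := by
  by_contra hv
  obtain ⟨p⟩ := hG.preconnected u v
  obtain ⟨d, -, d1, d2⟩ := p.exists_boundary_dart S hu hv
  exact d2 (hS _ d1 _ d.adj)

/-- A longest path of a connected graph of maximum degree at most two visits all vertices. -/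
theorem longest_path_surjective {V : Type*} {G : SimpleGraph V} (hG : G.Connected)
    (hdeg : ∀ o x y z, G.Adj o x → G.Adj o y → G.Adj o z → x = y ∨ x = z ∨ y = z)
    {n : ℕ} {f : ℕ → V} (hn : 0 < n) (hf : IsPathMap G n f)
    (hmax : ∀ m g, IsPathMap G m g → m ≤ n) (v : V) : ∃ i < n, f i = v := by
  refine eq_of_adj_of_closed hG (S := {v | ∃ i < n, f i = v}) ⟨0, hn, rfl⟩ ?_ v
  rintro _ ⟨i, hi, rfl⟩ w hw
  by_contra hcon
  have hcon : ∀ j < n, f j ≠ w := fun j hj h => hcon ⟨j, hj, h⟩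
  -- A missed neighbour `w` of an end would prolong the path; at an inner vertex it would be a third
  -- neighbour.
  rcases Nat.eq_zero_or_pos i with rfl | hi0
  · have := hmax (n + 1) (fun j => if j = 0 then w else f (j - 1)) ⟨?_, ?_⟩
    · omega
    · intro a ha b hb hab
      rcases a with _ | a <;> rcases b with _ | b
      · rfl
      · exact (hcon b (by omega) (by simpa using hab.symm)).elim
      · exact (hcon a (by omega) (by simpa using hab)).elim
      · have := hf.1 a (by omega) b (by omega) (by simpa using hab)
        omega
    · intro a ha
      rcases a with _ | a
      · simpa using hw.symm
      · simpa using hf.2 a (by omega)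
  rcases Nat.lt_or_ge (i + 1) n with hi1 | hi1
  · obtain ⟨k, rfl⟩ : ∃ k, i = k + 1 := ⟨i - 1, by omega⟩
    rcases hdeg (f (k + 1)) (f k) (f (k + 2)) w (hf.2 k hi).symm (hf.2 (k + 1) hi1) hw with
      h | h | h
    · have := hf.1 _ (by omega) _ (by omega) h
      omega
    · exact hcon k (by omega) h
    · exact hcon (k + 2) (by omega) h
  · have hin : n = i + 1 := by omega
    have := hmax (n + 1) (fun j => if j = n then w else f j) ⟨?_, ?_⟩
    · omega
    · intro a ha b hb hab
      by_cases h1 : a = n <;> by_cases h2 : b = n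
      · omega
      · simp only [h1, h2, if_true, if_false] at hab
        exact (hcon b (by omega) hab.symm).elim
      · simp only [h1, h2, if_true, if_false] at hab
        exact (hcon a (by omega) hab).elim
      · simp only [h1, h2, if_false] at hab
        exact hf.1 a (by omega) b (by omega) hab
    · intro a ha
      have h1 : a ≠ n := by omega
      by_cases h2 : a + 1 = n
      · obtain rfl : a = i := by omega
        simpa [h1, h2] using hw
      · simpa [h1, h2] using hf.2 a (by omega)

theorem isPathGraph_of_pathMap {V : Type*} {G : SimpleGraph V} {n : ℕ} {f : ℕ → V}
    (hf : IsPathMap G n f) (hs : ∀ v, ∃ i < n, f i = v)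
    (hadj : ∀ i j, i < j → j < n → G.Adj (f i) (f j) → j = i + 1) : IsPathGraph G := by
  refine ⟨n, ⟨(RelIso.symm ⟨Equiv.ofBijective (fun i : Fin n => f i) ⟨fun i j h =>
    Fin.ext (hf.1 i i.2 j j.2 h), fun v => ?_⟩, ?_⟩)⟩⟩
  · obtain ⟨i, hi, h⟩ := hs v
    exact ⟨⟨i, hi⟩, h⟩
  · intro i j
    rw [SimpleGraph.pathGraph_adj]
    change G.Adj (f i) (f j) ↔ _
    constructor
    · intro h
      rcases lt_trichotomy i.1 j.1 with hij | hij | hij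
      · exact Or.inl (hadj i j hij j.2 h).symm
      · exact (h.ne (congrArg f hij)).elim
      · exact Or.inr (hadj j i hij i.2 h.symm).symm
    · rintro (h | h)
      · have := hf.2 i (h ▸ j.2)
        rwa [h] at this
      · have := hf.2 j (h ▸ i.2)
        rw [h] at this
        exact this.symm

theorem isTriangleGraph_of_pathMap {V : Type*} {G : SimpleGraph V} {f : ℕ → V}
    (hf : IsPathMap G 3 f) (hs : ∀ v, ∃ i < 3, f i = v) (h02 : G.Adj (f 0) (f 2)) :
    IsTriangleGraph G := by
  refine ⟨(RelIso.symm ⟨Equiv.ofBijective (fun i : Fin 3 => f i) ⟨fun i j h =>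
    Fin.ext (hf.1 i i.2 j j.2 h), fun v => ?_⟩, ?_⟩)⟩
  · obtain ⟨i, hi, h⟩ := hs v
    exact ⟨⟨i, hi⟩, h⟩
  · have h01 := hf.2 0 (by norm_num)
    have h12 := hf.2 1 (by norm_num)
    intro i j
    change G.Adj (f i) (f j) ↔ _
    fin_cases i <;> fin_cases j <;> simp [h01, h12, h02, h01.symm, h12.symm, h02.symm]

/-! ### Necessity -/

/-- A connected graph whose arrangement is simplicial is a triangle or a path. -/
theorem isTriangleGraph_or_isPathGraph {V : Type*} [Fintype V] {G : SimpleGraph V}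
    (hG : G.Connected) (h : IsSimplicialArrangement (connectedSubgraphArrangement ℚ G)) :
    IsTriangleGraph G ∨ IsPathGraph G := by
  classical
  have hdeg : ∀ o x y z, G.Adj o x → G.Adj o y → G.Adj o z → x = y ∨ x = z ∨ y = z := by
    intro o x y z hx hy hz
    by_contra! hne
    obtain ⟨hxy, hxz, hyz⟩ := hne
    by_cases ayz : G.Adj y z
    · by_cases axy : G.Adj x y
      -- The 4-cycle o, x, y, z; adjacency of `x` and `z` plays no role.
      · refine not_simplicial_of_cycle (a := o) (b := y) (c := x) (D := {z}) hy.ne hx.ne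
          hxy.symm ?_ ?_ ?_ ?_ hx axy.symm (connected_pair hz) (connected_pair ayz) h
        · simpa using hz.ne
        · simpa using hyz
        · simpa using hxz
        · simp
      · exact not_simplicial_of_branch hz hx hy hxz.symm hyz.symm hxy axy h
    · exact not_simplicial_of_branch hx hy hz hxy hxz hyz ayz h
  have := hG.nonempty
  obtain ⟨n, f, hn, hf, hmax⟩ := exists_longest_path G
  have hs := longest_path_surjective hG hdeg hn hf hmax
  -- An inner vertex already has its two path neighbours, so a chord can only join the two ends.
  have hchord : ∀ i j, i < j → j < n → G.Adj (f i) (f j) → j ≠ i + 1 → i = 0 ∧ j + 1 = n := by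
    intro i j hij hj ha hne
    constructor
    · by_contra hi
      obtain ⟨k, rfl⟩ : ∃ k, i = k + 1 := ⟨i - 1, by omega⟩
      rcases hdeg (f (k + 1)) (f k) (f (k + 2)) (f j) (hf.2 k (by omega)).symm
        (hf.2 (k + 1) (by omega)) ha with h | h | h
      all_goals
        have := hf.1 _ (by omega) _ (by omega) h
        omega
    · by_contra hj'
      obtain ⟨k, rfl⟩ : ∃ k, j = k + 1 := ⟨j - 1, by omega⟩
      rcases hdeg (f (k + 1)) (f k) (f (k + 2)) (f i) (hf.2 k (by omega)).symm
        (hf.2 (k + 1) (by omega)) ha.symm with h | h | h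
      all_goals
        have := hf.1 _ (by omega) _ (by omega) h
        omega
  by_cases hpath : ∀ i j, i < j → j < n → G.Adj (f i) (f j) → j = i + 1
  · exact Or.inr (isPathGraph_of_pathMap hf hs hpath)
  left
  push Not at hpath
  obtain ⟨i, j, hij, hj, ha, hne⟩ := hpath
  obtain ⟨rfl, rfl⟩ := hchord i j hij hj ha hne
  obtain ⟨k, rfl⟩ : ∃ k, j = k + 2 := ⟨j - 2, by omega⟩
  rcases k with _ | k
  · exact isTriangleGraph_of_pathMap hf hs ha
  exfalso
  have hne' : ∀ a < k + 4, ∀ b < k + 4, a ≠ b → f a ≠ f b := fun a ha b hb hab h =>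
    hab (hf.1 a ha b hb h)
  have hnot : ∀ a < 3, f a ∉ (Finset.Icc 3 (3 + k)).image f := by
    intro a ha h
    obtain ⟨b, hb, hab⟩ := Finset.mem_image.1 h
    rw [Finset.mem_Icc] at hb
    exact hne' b (by omega) a (by omega) (by omega) hab
  have hlast : f (k + 3) ∈ (Finset.Icc 3 (3 + k)).image f :=
    Finset.mem_image_of_mem f (by simp; omega)
  have hfst : f 3 ∈ (Finset.Icc 3 (3 + k)).image f :=
    Finset.mem_image_of_mem f (by simp)
  have hseg := connected_path_segment hf 3 k (by omega)
  -- The arc from `f 3` to the end of the path is the block `D`: it meets `f 2` through `f 3`, and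
  -- `f 0` through the chord.
  refine not_simplicial_of_cycle (a := f 0) (b := f 2) (c := f 1)
    (D := (Finset.Icc 3 (3 + k)).image f) (hne' 0 (by omega) 2 (by omega) (by omega))
    (hne' 0 (by omega) 1 (by omega) (by omega)) (hne' 2 (by omega) 1 (by omega) (by omega))
    (hnot 0 (by omega)) (hnot 2 (by omega)) (hnot 1 (by omega)) ⟨_, hfst⟩
    (hf.2 0 (by omega)) (hf.2 1 (by omega)).symm ?_ ?_ h
  · refine connected_union hseg (connected_pair ha) (a := f (k + 3)) hlast (by simp) ?_
    intro v
    simp only [Finset.mem_insert, Finset.mem_singleton]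
    constructor
    · tauto
    · rintro (h | h | rfl)
      exacts [Or.inr h, Or.inl h, Or.inr hlast]
  · refine connected_union hseg (connected_pair (hf.2 2 (by omega))) (a := f 3) hfst (by simp) ?_
    intro v
    simp only [Finset.mem_insert, Finset.mem_singleton]
    constructor
    · tauto
    · rintro (h | h | rfl)
      exacts [Or.inr h, Or.inl h, Or.inr hfst]

/-! ### Sufficiency for paths: the braid arrangement -/

/-- An arrangement is simplicial if each of its chambers is cut out by coordinates of an
injective linear map. -/
theorem simplicial_of_coordinates {V ι : Type*} [Fintype V] [Fintype ι] {G : SimpleGraph V}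
    (e : ι ≃ V)
    (h : ∀ r : V → ℚ, (∀ I : Finset V, I.Nonempty → (G.induce (I : Set V)).Connected →
        ∑ i ∈ I, r i ≠ 0) →
      ∃ Φ : (V → ℚ) →ₗ[ℚ] (ι → ℚ), Function.Injective Φ ∧ ∀ s : V → ℚ, (∀ i, 0 < Φ s i) ↔
        ∀ I : Finset V, I.Nonempty → (G.induce (I : Set V)).Connected →
          0 < (∑ i ∈ I, s i) * ∑ i ∈ I, r i) :
    IsSimplicialArrangement (connectedSubgraphArrangement ℚ G) := by
  -- Chambers as classes of equal sign vectors, hence equal or disjoint.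
  set Ch : (V → ℚ) → Set (V → ℚ) := fun r => {s | ∀ I : Finset V, I.Nonempty →
    (G.induce (I : Set V)).Connected → 0 < (∑ i ∈ I, s i) * ∑ i ∈ I, r i} with hCh
  have htrans : ∀ {a b c : ℚ}, 0 < a * b → 0 < b * c → 0 < a * c := by
    intro a b c h1 h2
    have h3 : 0 < (a * c) * (b * b) := by nlinarith [mul_pos h1 h2]
    exact pos_of_mul_pos_left h3 (mul_self_nonneg b)
  have heq : ∀ r s, s ∈ Ch r → Ch s = Ch r := by
    intro r s hs
    ext t
    constructor
    · exact fun ht I hI hc => htrans (ht I hI hc) (hs I hI hc)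
    · exact fun ht I hI hc => htrans (ht I hI hc) (by rw [mul_comm]; exact hs I hI hc)
  refine ⟨{C | ∃ r ∈ arrangementComplement (connectedSubgraphArrangement ℚ G), C = Ch r},
    ?_, ?_, ?_⟩
  · rintro _ ⟨r, hr, rfl⟩
    obtain ⟨Φ, hΦ, hs⟩ := h r (mem_arrangementComplement_iff.1 hr)
    have hcard : Module.finrank ℚ (V → ℚ) = Module.finrank ℚ (ι → ℚ) := by
      simp [Fintype.card_congr e]
    refine ⟨(Module.Basis.ofEquivFun (LinearMap.linearEquivOfInjective Φ hΦ hcard)).reindex e,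
      ?_⟩
    ext s
    refine Iff.trans ?_ (mem_openCone_iff _ _).symm
    refine Iff.trans (hs s).symm ?_
    rw [← e.forall_congr_right]
    simp
  · rintro _ ⟨r, -, rfl⟩ _ ⟨r', -, rfl⟩ hne
    refine Set.disjoint_left.2 fun s hs hs' => hne ?_
    rw [← heq r s hs, ← heq r' s hs']
  · ext s
    constructor
    · rintro ⟨_, ⟨r, -, rfl⟩, hs⟩
      refine mem_arrangementComplement_iff.2 fun I hI hc h0 => ?_
      have := hs I hI hc
      rw [h0, zero_mul] at this
      exact this.false
    · exact fun hs => ⟨_, ⟨s, hs, rfl⟩, fun I hI hc =>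
        mul_self_pos.2 (mem_arrangementComplement_iff.1 hs I hI hc)⟩

/-- The braid arrangement is simplicial: if the forms are the differences of the values of
`S x` on `Fin (n + 1)`, then the chambers correspond to the orderings of these values. -/
theorem simplicial_of_differences {V : Type*} [Fintype V] {G : SimpleGraph V} {n : ℕ}
    (e : Fin n ≃ V) (S : (V → ℚ) →ₗ[ℚ] (Fin (n + 1) → ℚ))
    (hS : ∀ x, (∀ k, S x k = S x 0) → x = 0)
    (hform : ∀ I : Finset V, I.Nonempty → (G.induce (I : Set V)).Connected →
      ∃ i j, i < j ∧ ∀ x : V → ℚ, ∑ v ∈ I, x v = S x j - S x i)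
    (hform' : ∀ i j, i < j → ∃ I : Finset V, I.Nonempty ∧ (G.induce (I : Set V)).Connected ∧
      ∀ x : V → ℚ, ∑ v ∈ I, x v = S x j - S x i) :
    IsSimplicialArrangement (connectedSubgraphArrangement ℚ G) := by
  refine simplicial_of_coordinates e fun r hr => ?_
  have hinj : Function.Injective (S r) := by
    have key : ∀ i j, i < j → S r i ≠ S r j := by
      intro i j hij heq
      obtain ⟨I, hI, hc, hx⟩ := hform' i j hij
      exact hr I hI hc (by rw [hx, heq, sub_self])
    intro i j hij
    rcases lt_trichotomy i j with h | h | h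
    exacts [(key i j h hij).elim, h, (key j i h hij.symm).elim]
  -- The chamber of `r` consists of the `s` for which `σ` also sorts `S s`; consecutive differences
  -- detect this.
  set σ := Tuple.sort (S r) with hσ
  have hmono : StrictMono (S r ∘ σ) :=
    (Tuple.monotone_sort (S r)).strictMono_of_injective (hinj.comp σ.injective)
  refine ⟨LinearMap.pi fun i => (LinearMap.proj (R := ℚ) (φ := fun _ => ℚ) (σ i.succ) -
    LinearMap.proj (R := ℚ) (φ := fun _ => ℚ) (σ i.castSucc)) ∘ₗ S,
    ?_, fun s => ?_⟩
  · refine (injective_iff_map_eq_zero _).2 fun x hx => hS x ?_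
    have hstep : ∀ i : Fin n, S x (σ i.succ) = S x (σ i.castSucc) := fun i => by
      have := congrFun hx i
      simpa [sub_eq_zero] using this
    have hconst : ∀ k, S x (σ k) = S x (σ 0) := by
      intro k
      induction k using Fin.induction with
      | zero => rfl
      | succ i ih => rw [hstep, ih]
    intro k
    have h1 := hconst (σ.symm k)
    have h2 := hconst (σ.symm 0)
    simp only [Equiv.apply_symm_apply] at h1 h2
    rw [h1, h2]
  · have hiff : (∀ i : Fin n, 0 < S s (σ i.succ) - S s (σ i.castSucc)) ↔
        StrictMono (S s ∘ σ) := by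
      rw [Fin.strictMono_iff_lt_succ]
      simp
    refine Iff.trans (by simp) hiff |>.trans ?_
    constructor
    · intro hs I hI hc
      obtain ⟨i, j, hij, hx⟩ := hform I hI hc
      obtain ⟨a, rfl⟩ := σ.surjective i
      obtain ⟨b, rfl⟩ := σ.surjective j
      rw [hx, hx]
      rcases lt_trichotomy a b with h | h | h
      · exact mul_pos (sub_pos.2 (hs h)) (sub_pos.2 (hmono h))
      · exact (hij.ne (congrArg σ h)).elim
      · exact mul_pos_of_neg_of_neg (sub_neg.2 (hs h)) (sub_neg.2 (hmono h))
    · intro hs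
      rw [Fin.strictMono_iff_lt_succ]
      intro i
      have hlt : S r (σ i.castSucc) < S r (σ i.succ) := hmono i.castSucc_lt_succ
      change S s (σ i.castSucc) < S s (σ i.succ)
      rcases lt_trichotomy (σ i.castSucc) (σ i.succ) with h | h | h
      · obtain ⟨I, hI, hc, hx⟩ := hform' _ _ h
        have := hs I hI hc
        rw [hx, hx] at this
        exact sub_pos.1 (pos_of_mul_pos_left this (sub_pos.2 hlt).le)
      · rw [h] at hlt
        exact hlt.false.elim
      · obtain ⟨I, hI, hc, hx⟩ := hform' _ _ h
        have := hs I hI hc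
        rw [hx, hx] at this
        exact sub_neg.1 (neg_of_mul_pos_left this (sub_neg.2 hlt).le)

/-- The sum of `x` over the vertices that come before `k`. -/
def partialSum {V : Type*} [Fintype V] {n : ℕ} (e : V ≃ Fin n) :
    (V → ℚ) →ₗ[ℚ] (Fin (n + 1) → ℚ) :=
  LinearMap.pi fun k => ∑ v with (e v).1 < k.1, LinearMap.proj v

theorem partialSum_sub {V : Type*} [Fintype V] {n : ℕ} (e : V ≃ Fin n)
    {i j : Fin (n + 1)} (hij : i < j) {I : Finset V}
    (hI : ∀ v, v ∈ I ↔ i.1 ≤ (e v).1 ∧ (e v).1 < j.1) (x : V → ℚ) :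
    ∑ v ∈ I, x v = partialSum e x j - partialSum e x i := by
  classical
  have hij' : i.1 < j.1 := hij
  simp only [partialSum, LinearMap.pi_apply, LinearMap.sum_apply, LinearMap.proj_apply]
  rw [eq_sub_iff_add_eq, ← Finset.sum_union]
  · refine Finset.sum_congr ?_ fun _ _ => rfl
    ext v
    simp only [Finset.mem_union, hI, Finset.mem_filter, Finset.mem_univ, true_and]
    omega
  · refine Finset.disjoint_left.2 fun v hv hv' => ?_
    simp only [hI, Finset.mem_filter, Finset.mem_univ, true_and] at hv hv'
    omega

theorem simplicial_of_isPathGraph {V : Type*} [Fintype V] {G : SimpleGraph V}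
    (hG : IsPathGraph G) : IsSimplicialArrangement (connectedSubgraphArrangement ℚ G) := by
  classical
  obtain ⟨n, ⟨e⟩⟩ := hG
  refine simplicial_of_differences e.toEquiv.symm (partialSum e.toEquiv) ?_ ?_ ?_
  · intro x hx
    ext v
    have := partialSum_sub e.toEquiv (i := (e v).castSucc) (j := (e v).succ)
      (Fin.castSucc_lt_succ) (I := {v}) (fun w => by
        rw [Finset.mem_singleton, ← e.injective.eq_iff, Fin.ext_iff]
        simp only [Fin.val_castSucc, Fin.val_succ]
        change _ ↔ _ ≤ (e w).1 ∧ (e w).1 < _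
        omega) x
    rw [hx, hx (Fin.castSucc _), sub_self, Finset.sum_singleton] at this
    exact this
  · intro I hI hc
    obtain ⟨a, haI, ha⟩ := Finset.exists_min_image I (fun v => (e v).1) hI
    obtain ⟨b, hbI, hb⟩ := Finset.exists_max_image I (fun v => (e v).1) hI
    have hab : (e a).castSucc < (e b).succ := by
      have := ha b hbI
      rw [Fin.lt_def, Fin.val_castSucc, Fin.val_succ]
      omega
    refine ⟨(e a).castSucc, (e b).succ, hab, partialSum_sub e.toEquiv hab fun v => ?_⟩
    simp only [Fin.val_castSucc, Fin.val_succ]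
    change _ ↔ _ ≤ (e v).1 ∧ (e v).1 < _
    constructor
    · intro hv
      have := ha v hv
      have := hb v hv
      omega
    -- A walk in `I` from the least to the greatest position moves by one at each step, so it cannot
    -- jump over `v`.
    · rintro ⟨h1, h2⟩
      by_contra hv
      have hav : (e a).1 < (e v).1 := by
        refine lt_of_le_of_ne h1 fun h => hv ?_
        rwa [← e.injective (Fin.ext h)]
      obtain ⟨q⟩ := hc.preconnected ⟨a, haI⟩ ⟨b, hbI⟩
      obtain ⟨d, -, d1, d2⟩ := q.exists_boundary_dart {w | (e w.1).1 < (e v).1} hav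
        (fun h : (e b).1 < (e v).1 => by omega)
      have d1 : (e d.fst.1).1 < (e v).1 := d1
      have d2 : ¬ (e d.snd.1).1 < (e v).1 := d2
      have hadj : G.Adj d.fst.1 d.snd.1 := d.adj
      rw [← e.map_adj_iff, SimpleGraph.pathGraph_adj] at hadj
      have hne : (e d.snd.1).1 ≠ (e v).1 := fun h => hv (by
        rw [← e.injective (Fin.ext h)]; exact d.snd.2)
      omega
  · intro i j hij
    have hij' : i.1 < j.1 := hij
    have hin : i.1 < n := by omega
    -- The value for `k ≥ n` is a dummy.
    set f : ℕ → V := fun k => if h : k < n then e.symm ⟨k, h⟩ else e.symm ⟨i, hin⟩ with hf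
    have hef : ∀ k, k < n → (e (f k)).1 = k := fun k hk => by simp [hf, hk]
    have hpath : IsPathMap G n f := by
      refine ⟨fun a ha b hb hab => ?_, fun a ha => ?_⟩
      · rw [← hef a ha, ← hef b hb, hab]
      · rw [← e.map_adj_iff, SimpleGraph.pathGraph_adj, hef a (by omega), hef _ ha]
        exact Or.inl rfl
    refine ⟨_, ?_, connected_path_segment hpath i.1 (j.1 - i.1 - 1) (by omega),
      partialSum_sub e.toEquiv hij fun v => ?_⟩
    · exact ⟨f i, Finset.mem_image_of_mem f (by simp)⟩
    · simp only [Finset.mem_image, Finset.mem_Icc]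
      change _ ↔ _ ≤ (e v).1 ∧ (e v).1 < _
      constructor
      · rintro ⟨k, hk, rfl⟩
        rw [hef k (by omega)]
        omega
      · intro h
        exact ⟨(e v).1, by omega, e.injective (Fin.ext (hef _ (e v).2))⟩

/-! ### Sufficiency for the triangle -/

/-- The sign conditions `0 < α s * α r` for the seven sums `α` of a nonempty subset of
`X, Y, Z`. -/
def SameSigns {E : Type*} [AddCommGroup E] [Module ℚ E] (X Y Z : E →ₗ[ℚ] ℚ) (r s : E) : Prop :=
  0 < X s * X r ∧ 0 < Y s * Y r ∧ 0 < Z s * Z r ∧ 0 < (X s + Y s) * (X r + Y r) ∧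
    0 < (X s + Z s) * (X r + Z r) ∧ 0 < (Y s + Z s) * (Y r + Z r) ∧
    0 < (X s + Y s + Z s) * (X r + Y r + Z r)

/-- The chamber of `r` for the seven sums of subsets of `X, Y, Z` is cut out by three linearly
independent forms. -/
def HasSimplicialChamber {E : Type*} [AddCommGroup E] [Module ℚ E] (X Y Z : E →ₗ[ℚ] ℚ)
    (r : E) : Prop :=
  ∃ A B C : E →ₗ[ℚ] ℚ, (∀ s, A s = 0 → B s = 0 → C s = 0 → X s = 0 ∧ Y s = 0 ∧ Z s = 0) ∧
    ∀ s, (0 < A s ∧ 0 < B s ∧ 0 < C s) ↔ SameSigns X Y Z r s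

namespace HasSimplicialChamber

variable {E : Type*} [AddCommGroup E] [Module ℚ E] {X Y Z : E →ₗ[ℚ] ℚ} {r : E}

theorem rotate (h : HasSimplicialChamber X Y Z r) : HasSimplicialChamber Y Z X r := by
  obtain ⟨A, B, C, h1, h2⟩ := h
  refine ⟨A, B, C, fun s a b c => ?_, fun s => (h2 s).trans ?_⟩
  · have := h1 s a b c
    tauto
  · rw [SameSigns, SameSigns, add_comm (Y s) (X s), add_comm (Y r) (X r), add_comm (Z s) (X s),
      add_comm (Z r) (X r), add_comm (Y s + Z s) (X s), add_comm (Y r + Z r) (X r),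
      ← add_assoc, ← add_assoc]
    tauto

theorem neg (h : HasSimplicialChamber (-X) (-Y) (-Z) r) : HasSimplicialChamber X Y Z r := by
  obtain ⟨A, B, C, h1, h2⟩ := h
  refine ⟨A, B, C, fun s a b c => ?_, fun s => (h2 s).trans ?_⟩
  · simpa using h1 s a b c
  · simp only [SameSigns, LinearMap.neg_apply, ← neg_add, neg_mul_neg]

theorem of_pos (hX : 0 < X r) (hY : 0 < Y r) (hZ : 0 < Z r) : HasSimplicialChamber X Y Z r := by
  refine ⟨X, Y, Z, by tauto, fun s => ?_⟩
  rw [SameSigns, mul_pos_iff_of_pos_right hX, mul_pos_iff_of_pos_right hY,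
    mul_pos_iff_of_pos_right hZ, mul_pos_iff_of_pos_right (by linarith),
    mul_pos_iff_of_pos_right (by linarith), mul_pos_iff_of_pos_right (by linarith),
    mul_pos_iff_of_pos_right (by linarith)]
  constructor
  · rintro ⟨a, b, c⟩
    refine ⟨a, b, c, ?_, ?_, ?_, ?_⟩ <;> linarith
  · tauto

/-- Only the signs of X + Z, Y + Z and X + Y + Z remain open. If one of the first two is positive,
so is the third; this leaves five chambers, each with three explicit walls whose positivity implies
the other inequalities. -/
theorem of_pos_of_pos_of_neg (hX : 0 < X r) (hY : 0 < Y r) (hZ : Z r < 0) (hXZ : X r + Z r ≠ 0)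
    (hYZ : Y r + Z r ≠ 0) (hXYZ : X r + Y r + Z r ≠ 0) : HasSimplicialChamber X Y Z r := by
  have hneg : ∀ {a b : ℚ}, b < 0 → (0 < a * b ↔ a < 0) := fun {a b} hb =>
    ⟨fun h => neg_of_mul_pos_left h hb.le, fun h => mul_pos_of_neg_of_neg h hb⟩
  have hXY : 0 < X r + Y r := by linarith
  simp only [HasSimplicialChamber, SameSigns, mul_pos_iff_of_pos_right hX,
    mul_pos_iff_of_pos_right hY, mul_pos_iff_of_pos_right hXY, hneg hZ]
  rcases lt_or_gt_of_ne hXZ with h1 | h1 <;> rcases lt_or_gt_of_ne hYZ with h2 | h2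
  · simp only [hneg h1, hneg h2]
    rcases lt_or_gt_of_ne hXYZ with h3 | h3
    · refine ⟨X, Y, -(X + Y + Z), fun s => ?_, fun s => ?_⟩ <;>
        simp only [hneg h3, LinearMap.neg_apply, LinearMap.add_apply]
      · intro a b c
        refine ⟨?_, ?_, ?_⟩ <;> linarith
      · constructor
        · rintro ⟨a, b, c⟩
          refine ⟨?_, ?_, ?_, ?_, ?_, ?_, ?_⟩ <;> linarith
        · rintro ⟨a, b, c, d, f, g, k⟩
          refine ⟨?_, ?_, ?_⟩ <;> linarith
    · refine ⟨-(X + Z), -(Y + Z), X + Y + Z, fun s => ?_, fun s => ?_⟩ <;>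
        simp only [mul_pos_iff_of_pos_right h3, LinearMap.neg_apply, LinearMap.add_apply]
      · intro a b c
        refine ⟨?_, ?_, ?_⟩ <;> linarith
      · constructor
        · rintro ⟨a, b, c⟩
          refine ⟨?_, ?_, ?_, ?_, ?_, ?_, ?_⟩ <;> linarith
        · rintro ⟨a, b, c, d, f, g, k⟩
          refine ⟨?_, ?_, ?_⟩ <;> linarith
  · have h3 : 0 < X r + Y r + Z r := by linarith
    simp only [hneg h1, mul_pos_iff_of_pos_right h2, mul_pos_iff_of_pos_right h3]
    refine ⟨X, Y + Z, -(X + Z), fun s => ?_, fun s => ?_⟩ <;>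
      simp only [LinearMap.neg_apply, LinearMap.add_apply]
    · intro a b c
      refine ⟨?_, ?_, ?_⟩ <;> linarith
    · constructor
      · rintro ⟨a, b, c⟩
        refine ⟨?_, ?_, ?_, ?_, ?_, ?_, ?_⟩ <;> linarith
      · rintro ⟨a, b, c, d, f, g, k⟩
        refine ⟨?_, ?_, ?_⟩ <;> linarith
  · have h3 : 0 < X r + Y r + Z r := by linarith
    simp only [hneg h2, mul_pos_iff_of_pos_right h1, mul_pos_iff_of_pos_right h3]
    refine ⟨Y, X + Z, -(Y + Z), fun s => ?_, fun s => ?_⟩ <;>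
      simp only [LinearMap.neg_apply, LinearMap.add_apply]
    · intro a b c
      refine ⟨?_, ?_, ?_⟩ <;> linarith
    · constructor
      · rintro ⟨a, b, c⟩
        refine ⟨?_, ?_, ?_, ?_, ?_, ?_, ?_⟩ <;> linarith
      · rintro ⟨a, b, c, d, f, g, k⟩
        refine ⟨?_, ?_, ?_⟩ <;> linarith
  · have h3 : 0 < X r + Y r + Z r := by linarith
    simp only [mul_pos_iff_of_pos_right h1, mul_pos_iff_of_pos_right h2,
      mul_pos_iff_of_pos_right h3]
    refine ⟨-Z, X + Z, Y + Z, fun s => ?_, fun s => ?_⟩ <;>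
      simp only [LinearMap.neg_apply, LinearMap.add_apply]
    · intro a b c
      refine ⟨?_, ?_, ?_⟩ <;> linarith
    · constructor
      · rintro ⟨a, b, c⟩
        refine ⟨?_, ?_, ?_, ?_, ?_, ?_, ?_⟩ <;> linarith
      · rintro ⟨a, b, c, d, f, g, k⟩
        refine ⟨?_, ?_, ?_⟩ <;> linarith

theorem of_two_pos (hX : 0 < X r) (hY : 0 < Y r) (hZ : Z r ≠ 0) (hXZ : X r + Z r ≠ 0)
    (hYZ : Y r + Z r ≠ 0) (hXYZ : X r + Y r + Z r ≠ 0) : HasSimplicialChamber X Y Z r := by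
  rcases lt_or_gt_of_ne hZ with h | h
  · exact of_pos_of_pos_of_neg hX hY h hXZ hYZ hXYZ
  · exact of_pos hX hY h

/-- Two of the three values share a sign; negation and rotation make them positive and put them
first. -/
theorem of_pos_of_ne (hX : 0 < X r) (hY : Y r ≠ 0) (hZ : Z r ≠ 0) (hXY : X r + Y r ≠ 0)
    (hXZ : X r + Z r ≠ 0) (hYZ : Y r + Z r ≠ 0) (hXYZ : X r + Y r + Z r ≠ 0) :
    HasSimplicialChamber X Y Z r := by
  rcases lt_or_gt_of_ne hY with h | h
  · rcases lt_or_gt_of_ne hZ with h' | h'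
    · refine neg (rotate (rotate (of_two_pos (neg_pos.2 h) (neg_pos.2 h') (neg_ne_zero.2 hX.ne')
        (fun e => hXY ?_) (fun e => hXZ ?_) fun e => hXYZ ?_)))
      all_goals
        simp only [LinearMap.neg_apply] at e
        linarith
    · exact rotate (of_two_pos h' hX hY (by rwa [add_comm]) hXY (by rwa [add_assoc, add_comm]))
  · exact of_two_pos hX h hZ hXZ hYZ hXYZ

theorem of_ne (hX : X r ≠ 0) (hY : Y r ≠ 0) (hZ : Z r ≠ 0) (hXY : X r + Y r ≠ 0)
    (hXZ : X r + Z r ≠ 0) (hYZ : Y r + Z r ≠ 0) (hXYZ : X r + Y r + Z r ≠ 0) :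
    HasSimplicialChamber X Y Z r := by
  rcases lt_or_gt_of_ne hX with h | h
  · refine neg (of_pos_of_ne (neg_pos.2 h) ?_ ?_ ?_ ?_ ?_ ?_) <;>
      simpa only [LinearMap.neg_apply, ← neg_add, neg_ne_zero]
  · exact of_pos_of_ne h hY hZ hXY hXZ hYZ hXYZ

end HasSimplicialChamber

/-- Every nonempty vertex set of a triangle is connected, so the forms are exactly the seven sums in
`SameSigns`. -/
theorem simplicial_of_isTriangleGraph {V : Type*} [Fintype V] {G : SimpleGraph V}
    (hG : IsTriangleGraph G) : IsSimplicialArrangement (connectedSubgraphArrangement ℚ G) := by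
  classical
  obtain ⟨e⟩ := hG
  have hadj : ∀ u v, u ≠ v → G.Adj u v := fun u v h => by
    rw [← e.map_adj_iff, SimpleGraph.top_adj]
    exact e.injective.ne h
  have hconn : ∀ I : Finset V, I.Nonempty → (G.induce (I : Set V)).Connected := by
    intro I hI
    have : Nonempty (I : Set V) := hI.to_subtype
    refine SimpleGraph.Connected.mk fun u v => ?_
    by_cases h : u = v
    · rw [h]
    · exact SimpleGraph.Adj.reachable
        (SimpleGraph.induce_adj.2 (hadj u v fun h' => h (Subtype.ext h')))
  set a := e.symm 0 with ha
  set b := e.symm 1 with hb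
  set c := e.symm 2 with hc
  have hab : a ≠ b := e.symm.injective.ne (by decide)
  have hac : a ≠ c := e.symm.injective.ne (by decide)
  have hbc : b ≠ c := e.symm.injective.ne (by decide)
  have hcover : ∀ v, v = a ∨ v = b ∨ v = c := by
    intro v
    obtain ⟨k, rfl⟩ := e.symm.surjective v
    fin_cases k
    exacts [Or.inl rfl, Or.inr (Or.inl rfl), Or.inr (Or.inr rfl)]
  have huniv : (Finset.univ : Finset V) = {a, b, c} := by
    ext v
    simpa using hcover v
  have hsum : ∀ (I : Finset V) (x : V → ℚ), ∑ v ∈ I, x v =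
      (if a ∈ I then x a else 0) + (if b ∈ I then x b else 0) + (if c ∈ I then x c else 0) := by
    intro I x
    rw [← Finset.univ_inter I, ← Finset.sum_ite_mem, huniv, Finset.sum_insert (by simp [hab, hac]),
      Finset.sum_pair hbc, add_assoc]
    simp
  refine simplicial_of_coordinates e.toEquiv.symm fun r hr => ?_
  have hr' : ∀ I : Finset V, I.Nonempty → ∑ v ∈ I, r v ≠ 0 := fun I hI => hr I hI (hconn I hI)
  have s1 : ∀ x : V → ℚ, ∑ v ∈ {a}, x v = x a := fun x => by simp
  have s2 : ∀ x : V → ℚ, ∑ v ∈ {b}, x v = x b := fun x => by simp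
  have s3 : ∀ x : V → ℚ, ∑ v ∈ {c}, x v = x c := fun x => by simp
  have s4 : ∀ x : V → ℚ, ∑ v ∈ {a, b}, x v = x a + x b := fun x => Finset.sum_pair hab
  have s5 : ∀ x : V → ℚ, ∑ v ∈ {a, c}, x v = x a + x c := fun x => Finset.sum_pair hac
  have s6 : ∀ x : V → ℚ, ∑ v ∈ {b, c}, x v = x b + x c := fun x => Finset.sum_pair hbc
  have s7 : ∀ x : V → ℚ, ∑ v ∈ {a, b, c}, x v = x a + x b + x c := fun x => by
    rw [Finset.sum_insert (by simp [hab, hac]), Finset.sum_pair hbc, add_assoc]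
  have r1 : r a ≠ 0 := s1 r ▸ hr' {a} (by simp)
  have r2 : r b ≠ 0 := s2 r ▸ hr' {b} (by simp)
  have r3 : r c ≠ 0 := s3 r ▸ hr' {c} (by simp)
  have r4 : r a + r b ≠ 0 := s4 r ▸ hr' {a, b} (by simp)
  have r5 : r a + r c ≠ 0 := s5 r ▸ hr' {a, c} (by simp)
  have r6 : r b + r c ≠ 0 := s6 r ▸ hr' {b, c} (by simp)
  have r7 : r a + r b + r c ≠ 0 := s7 r ▸ hr' {a, b, c} (by simp)
  obtain ⟨A, B, C, h1, h2⟩ := HasSimplicialChamber.of_ne (X := LinearMap.proj a)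
    (Y := LinearMap.proj b) (Z := (LinearMap.proj c : (V → ℚ) →ₗ[ℚ] ℚ)) (r := r)
    r1 r2 r3 r4 r5 r6 r7
  refine ⟨LinearMap.pi ![A, B, C], ?_, fun s => ?_⟩
  · refine (injective_iff_map_eq_zero _).2 fun x hx => ?_
    obtain ⟨xa, xb, xc⟩ := h1 x (congrFun hx 0) (congrFun hx 1) (congrFun hx 2)
    ext v
    rcases hcover v with rfl | rfl | rfl
    exacts [xa, xb, xc]
  · have hfin : (∀ i, 0 < LinearMap.pi ![A, B, C] s i) ↔ 0 < A s ∧ 0 < B s ∧ 0 < C s := by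
      simp [Fin.forall_fin_succ]
    rw [hfin, h2]
    simp only [SameSigns, LinearMap.proj_apply]
    constructor
    · rintro ⟨k1, k2, k3, k4, k5, k6, k7⟩ I hI -
      rw [hsum, hsum]
      by_cases ia : a ∈ I <;> by_cases ib : b ∈ I <;> by_cases ic : c ∈ I <;>
        simp only [ia, ib, ic, if_true, if_false, add_zero, zero_add]
      all_goals first | assumption | skip
      obtain ⟨v, hv⟩ := hI
      rcases hcover v with rfl | rfl | rfl <;> contradiction
    · intro h
      have h' : ∀ I : Finset V, I.Nonempty → 0 < (∑ v ∈ I, s v) * ∑ v ∈ I, r v :=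
        fun I hI => h I hI (hconn I hI)
      refine ⟨?_, ?_, ?_, ?_, ?_, ?_, ?_⟩
      · simpa only [s1] using h' {a} (by simp)
      · simpa only [s2] using h' {b} (by simp)
      · simpa only [s3] using h' {c} (by simp)
      · simpa only [s4] using h' {a, b} (by simp)
      · simpa only [s5] using h' {a, c} (by simp)
      · simpa only [s6] using h' {b, c} (by simp)
      · simpa only [s7] using h' {a, b, c} (by simp)

theorem mainTheorem5 {V : Type*} [Fintype V] (G : SimpleGraph V) (hG : G.Connected) :
    IsSimplicialArrangement (connectedSubgraphArrangement ℚ G) ↔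
      (IsTriangleGraph G ∨ IsPathGraph G) :=
  ⟨isTriangleGraph_or_isPathGraph hG,
    fun h => h.elim simplicial_of_isTriangleGraph simplicial_of_isPathGraph⟩
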